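/- **Theorem 4.7.** All graphs are undirected and simple. Let $G$ be a finite, bipartite, connected graph with at least two vertices. Suppose that $G$ does not fold to an edge, i.e. no (possibly empty) sequence of folds turns $G$ into a single edge $K_2$; here a fold of a graph deletes a vertex $v$ for which there is a vertex $u \neq v$ with $N(v) \subseteq N(u)$, where $N$ denotes the neighborhood in the current graph. Suppose also that $G$ contains neither $H_1$ (a 6-cycle together with a chord joining two antipodal vertices) nor $H_2 = K_{2,3}$ as a (not necessarily induced) subgraph. Then $\mathrm{Hom}(G, K_3)$ is disconnected, i.e. it is non-empty and not connected. Here $\mathrm{Hom}(G, K_3)$ is the polyhedral complex whose cells are the maps $\eta : V(G) \to 2^{V(K_3)} \setminus \{\varnothing\}$ such that $\eta(x) \times \eta(y) \subseteq E(K_3)$ (every element of $\eta(x)$ is adjacent to every element of $\eta(y)$) whenever $\{x, y\} \in E(G)$; the closed cell of $\eta$ is the product $\prod_{v \in V(G)} \Delta^{\eta(v)}$, where $\Delta^{\eta(v)}$ is the simplex with vertex set $\eta(v)$, and $\eta$ is a face of $\tau$ if $\eta(v) \subseteq \tau(v)$ for all $v$. -/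

import Mathlib

/-- `η : V → Set W` is a cell of the complex `Hom(G, H)`: a map assigning to every vertex of `G` a
non-empty set of vertices of `H` such that `η x × η y ⊆ E(H)` whenever `x` and `y` are adjacent. -/
structure IsHomCell {V W : Type*} (G : SimpleGraph V) (H : SimpleGraph W) (η : V → Set W) :
    Prop where
  nonempty : ∀ x, (η x).Nonempty
  adj : ∀ x y, G.Adj x y → ∀ i ∈ η x, ∀ j ∈ η y, H.Adj i j

/-- The closed geometric cell of `η`: the product over the vertices `x` of `G` of the closed
simplices spanned by the sets `η x`, inside the product of copies of the standard simplex on the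
vertex set of `H` (points are families of barycentric coordinates). -/
def homCellRealization {V W : Type*} [Fintype W] (η : V → Set W) : Set (V → W → ℝ) :=
  {p | ∀ x, p x ∈ stdSimplex ℝ W ∧ ∀ i, p x i ≠ 0 → i ∈ η x}

/-- The (geometric realization of the) polyhedral complex `Hom(G, H)` for finite graphs: the union
of its closed cells, as a subspace of the finite-dimensional space `V → W → ℝ`. -/
def homComplex {V W : Type*} [Fintype W] (G : SimpleGraph V) (H : SimpleGraph W) :
    Set (V → W → ℝ) :=
  ⋃ η ∈ {η : V → Set W | IsHomCell G H η}, homCellRealization η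

/-- `FoldsTo G S`: the induced subgraph of `G` on `S` is obtained from `G` by a (possibly empty)
sequence of folds. A fold of the current induced subgraph on `S` deletes a vertex `v` for which
there is another vertex `u` with `N(v) ⊆ N(u)`, neighborhoods being taken in that subgraph. -/
inductive FoldsTo {V : Type*} (G : SimpleGraph V) : Set V → Prop
  | refl : FoldsTo G Set.univ
  | fold (S : Set V) (v u : V) (hS : FoldsTo G S) (hv : v ∈ S) (hu : u ∈ S) (hne : v ≠ u)
      (hN : G.neighborSet v ∩ S ⊆ G.neighborSet u ∩ S) : FoldsTo G (S \ {v})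

/-- `G` folds to an edge: some sequence of folds ends in a graph that consists of two adjacent
vertices. -/
def FoldsToEdge {V : Type*} (G : SimpleGraph V) : Prop :=
  ∃ a b : V, G.Adj a b ∧ FoldsTo G {a, b}

/-- The graph `H₁`: the 6-cycle `0, 1, 2, 3, 4, 5` together with the antipodal chord `{0, 3}`. -/
def graphH₁ : SimpleGraph (Fin 6) :=
  SimpleGraph.cycleGraph 6 ⊔ SimpleGraph.edge 0 3

/-- The graph `H₂ = K_{2,3}`. -/
def graphH₂ : SimpleGraph (Fin 2 ⊕ Fin 3) :=
  completeBipartiteGraph (Fin 2) (Fin 3)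

/-! The winding of a 3-colouring along a fixed closed walk is constant on each cell, hence on
components of `Hom(G, K₃)`. A 2-colouring has winding `0`, so it suffices to find a colouring with
non-zero winding.

Folds are retractions, so such a colouring may be sought on a fold-free induced subgraph and pulled
back. There, excluding `H₁` makes "lying in a common 4-cycle through `a`" transitive on the
neighbors of `a`, and some walk never has three consecutive vertices in a 4-cycle. At a first return
this walk closes up through a vertex `a`, whose neighbors split into two parts met by no common
4-cycle. A map to the hexagon separating these parts, reduced modulo 3, winds along the closed walk
(`exists_winding_coloring`). -/

/-! ### Winding numbers of 3-colourings along walks -/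

/-- The integer `0`, `1` or `-1` congruent to `b - a` modulo `3`. -/
def colorStep (a b : Fin 3) : ℤ :=
  if b = a then 0 else if b = a + 1 then 1 else -1

/-- The total increment of a 3-colouring along a walk. -/
def windingSum {V : Type*} {G : SimpleGraph V} (c : V → Fin 3) :
    {u v : V} → G.Walk u v → ℤ
  | _, _, .nil => 0
  | u, _, .cons (v := v) _ p => colorStep (c u) (c v) + windingSum c p

theorem windingSum_append {V : Type*} {G : SimpleGraph V} (c : V → Fin 3) {u v w : V}
    (p : G.Walk u v) (q : G.Walk v w) :
    windingSum c (p.append q) = windingSum c p + windingSum c q := by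
  induction p with
  | nil => simp [windingSum]
  | cons h p ih => simp [windingSum, ih, add_assoc]

theorem windingSum_map {V W : Type*} {G : SimpleGraph V} {H : SimpleGraph W} (φ : G →g H)
    (c : W → Fin 3) {u v : V} (p : G.Walk u v) :
    windingSum c (p.map φ) = windingSum (c ∘ φ) p := by
  induction p with
  | nil => simp [windingSum]
  | cons h p ih => simp [windingSum, ih]

theorem windingSum_eq_sub {V : Type*} {G : SimpleGraph V} (c : V → Fin 3) (g : V → ℤ)
    (hg : ∀ x y, G.Adj x y → colorStep (c x) (c y) = g y - g x) {u v : V} (p : G.Walk u v) :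
    windingSum c p = g v - g u := by
  induction p with
  | nil => simp [windingSum]
  | cons h p ih => rw [windingSum, ih, hg _ _ h]; ring

/-- With three colours, `a = a'` or `b = b'`. Changing a colour by `±1` modulo 3 beside a fixed
neighbor lifts to a move by `∓2` in `ℤ`, whence the factor `-2`; these terms telescope along a walk.
-/
theorem colorStep_sub_colorStep : ∀ a a' b b' : Fin 3, a ≠ b → a ≠ b' → a' ≠ b → a' ≠ b' →
    colorStep a' b' = colorStep a b + (-2 * colorStep b b' - -2 * colorStep a a') := by
  decide

/-- Two colourings in a common cell of `Hom(G, K₃)` have the same winding along closed walks. -/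
theorem windingSum_eq_of_mem_cell {V : Type*} {G : SimpleGraph V} {η : V → Set (Fin 3)}
    (hη : IsHomCell G (SimpleGraph.completeGraph (Fin 3)) η) {c c' : V → Fin 3}
    (hc : ∀ x, c x ∈ η x) (hc' : ∀ x, c' x ∈ η x) {u : V} (p : G.Walk u u) :
    windingSum c' p = windingSum c p := by
  have key : ∀ {u v : V} (p : G.Walk u v), windingSum c' p =
      windingSum c p + (-2 * colorStep (c v) (c' v) - -2 * colorStep (c u) (c' u)) := by
    intro u v p
    induction p with
    | nil => simp [windingSum]
    | @cons x y z h p ih =>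
      have hne : ∀ i ∈ η x, ∀ j ∈ η y, i ≠ j := fun i hi j hj => hη.adj x y h i hi j hj
      rw [windingSum, windingSum, ih, colorStep_sub_colorStep (c x) (c' x) (c y) (c' y)
        (hne _ (hc x) _ (hc y)) (hne _ (hc x) _ (hc' y)) (hne _ (hc' x) _ (hc y))
        (hne _ (hc' x) _ (hc' y))]
      ring
  simpa using key p

/-! ### Separating `Hom(G, K₃)` by a winding number -/

theorem isClosed_homCellRealization {V W : Type*} [Fintype W] (η : V → Set W) :
    IsClosed (homCellRealization η) := by
  have : homCellRealization η = ⋂ x, ((fun p : V → W → ℝ => p x) ⁻¹' stdSimplex ℝ W ∩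
      ⋂ i, {p : V → W → ℝ | p x i ≠ 0 → i ∈ η x}) := by
    ext p
    simp [homCellRealization]
  rw [this]
  refine isClosed_iInter fun x => IsClosed.inter
    ((isClosed_stdSimplex ℝ W).preimage (continuous_apply x)) (isClosed_iInter fun i => ?_)
  by_cases hi : i ∈ η x
  · simp [hi]
  · simpa [hi] using isClosed_eq (f := fun p : V → W → ℝ => p x i) (g := fun _ => 0)
      (by fun_prop) (by fun_prop)

theorem exists_selection_of_mem_homCellRealization {V W : Type*} [Fintype W]
    {p : V → W → ℝ} (hp : ∀ x, p x ∈ stdSimplex ℝ W) : ∃ c : V → W, ∀ x, p x (c x) ≠ 0 := by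
  have h : ∀ x, ∃ i, p x i ≠ 0 := by
    intro x
    by_contra! h
    have := (hp x).2
    simp [h] at this
  choose c hc using h
  exact ⟨c, hc⟩

theorem isHomCell_singleton {V W : Type*} {G : SimpleGraph V} {H : SimpleGraph W} (c : V → W)
    (hc : ∀ x y, G.Adj x y → H.Adj (c x) (c y)) : IsHomCell G H fun x => {c x} where
  nonempty x := Set.singleton_nonempty _
  adj x y h i hi j hj := by
    rw [Set.mem_singleton_iff] at hi hj
    subst hi hj
    exact hc x y h

theorem single_mem_homCellRealization {V W : Type*} [Fintype W] [DecidableEq W] (c : V → W) :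
    (fun x => Pi.single (c x) (1 : ℝ)) ∈ homCellRealization fun x => ({c x} : Set W) := by
  intro x
  refine ⟨single_mem_stdSimplex ℝ (c x), fun i hi => ?_⟩
  by_contra h
  exact hi (Pi.single_eq_of_ne h 1)

/-- Two proper 3-colourings with different winding along a closed walk disconnect `Hom(G, K₃)`. -/
theorem not_isPreconnected_homComplex {V : Type*} [Finite V] (G : SimpleGraph V)
    {c₀ c₁ : V → Fin 3} (h₀ : ∀ x y, G.Adj x y → c₀ x ≠ c₀ y)
    (h₁ : ∀ x y, G.Adj x y → c₁ x ≠ c₁ y) {u : V} (w : G.Walk u u)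
    (hw : windingSum c₀ w ≠ windingSum c₁ w) :
    ¬ IsPreconnected (homComplex G (SimpleGraph.completeGraph (Fin 3))) := by
  let K : Set ℤ → Set (V → Fin 3 → ℝ) := fun s =>
    ⋃ η ∈ {η : V → Set (Fin 3) | IsHomCell G (SimpleGraph.completeGraph (Fin 3)) η ∧
      ∀ c : V → Fin 3, (∀ x, c x ∈ η x) → windingSum c w ∈ s}, homCellRealization η
  have hclosed (s : Set ℤ) : IsClosed (K s) :=
    (Set.toFinite _).isClosed_biUnion fun η _ => isClosed_homCellRealization η
  have hmem (c : V → Fin 3) (hc : ∀ x y, G.Adj x y → c x ≠ c y) (s : Set ℤ)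
      (hs : windingSum c w ∈ s) : (homComplex G (SimpleGraph.completeGraph (Fin 3)) ∩ K s).Nonempty := by
    refine ⟨_, Set.mem_biUnion (isHomCell_singleton c hc) (single_mem_homCellRealization c),
      Set.mem_biUnion ⟨isHomCell_singleton c hc, fun c' hc' => ?_⟩
        (single_mem_homCellRealization c)⟩
    rwa [show c' = c from funext hc']
  intro hpre
  have hcover : homComplex G (SimpleGraph.completeGraph (Fin 3)) ⊆
      K {windingSum c₀ w} ∪ K {windingSum c₀ w}ᶜ := by
    intro p hp
    obtain ⟨η, hη, hpη⟩ := Set.mem_iUnion₂.1 hp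
    obtain ⟨c, hc⟩ := exists_selection_of_mem_homCellRealization fun x => (hpη x).1
    have hcη : ∀ x, c x ∈ η x := fun x => (hpη x).2 _ (hc x)
    by_cases h : windingSum c w = windingSum c₀ w
    · refine Or.inl (Set.mem_biUnion ⟨hη, fun c' hc' => ?_⟩ hpη)
      rw [windingSum_eq_of_mem_cell hη hcη hc' w]
      exact h
    · refine Or.inr (Set.mem_biUnion ⟨hη, fun c' hc' => ?_⟩ hpη)
      rw [windingSum_eq_of_mem_cell hη hcη hc' w]
      exact h
  obtain ⟨p, -, hp, hp'⟩ := isPreconnected_closed_iff.1 hpre (K {windingSum c₀ w})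
    (K {windingSum c₀ w}ᶜ) (hclosed _) (hclosed _) hcover (hmem c₀ h₀ _ rfl) (hmem c₁ h₁ _ hw.symm)
  obtain ⟨η, ⟨-, hη⟩, hpη⟩ := Set.mem_iUnion₂.1 hp
  obtain ⟨η', ⟨-, hη'⟩, hpη'⟩ := Set.mem_iUnion₂.1 hp'
  -- A colouring chosen in the support of `p` lies in both cells, so its winding would be in both
  -- sets.
  obtain ⟨c, hc⟩ := exists_selection_of_mem_homCellRealization fun x => (hpη x).1
  exact hη' c (fun x => (hpη' x).2 _ (hc x)) (hη c fun x => (hpη x).2 _ (hc x))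

/-! ### Folds are retractions -/

theorem FoldsTo.exists_retraction {V : Type*} {G : SimpleGraph V} {S : Set V}
    (h : FoldsTo G S) : ∃ ρ : G →g G.induce S, ∀ x : S, ρ x = x := by
  induction h with
  | refl => exact ⟨⟨fun x => ⟨x, trivial⟩, fun h => h⟩, fun x => rfl⟩
  | fold S v u hS hv hu hne hN ih =>
    classical
    obtain ⟨ρ, hρ⟩ := ih
    let φ : G.induce S →g G.induce (S \ {v}) :=
      { toFun := fun x => if hx : x.1 = v then ⟨u, hu, hne.symm⟩ else ⟨x, x.2, hx⟩
        map_rel' := by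
          rintro ⟨x, hx⟩ ⟨y, hy⟩ (hxy : G.Adj x y)
          by_cases hxv : x = v <;> by_cases hyv : y = v
          · subst hxv hyv
            exact (G.loopless.irrefl _ hxy).elim
          · subst hxv
            simpa [hyv] using (hN ⟨hxy, hy⟩).1
          · subst hyv
            simpa [hxv] using (hN ⟨hxy.symm, hx⟩).1.symm
          · simpa [hxv, hyv] using hxy }
    refine ⟨φ.comp ρ, fun x => ?_⟩
    have h1 : ρ x = ⟨x, x.2.1⟩ := hρ ⟨x, x.2.1⟩
    have h2 : x.1 ≠ v := x.2.2
    simp [φ, h1, h2]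

/-! ### A winding colouring of a graph without folds -/

/-- In a properly 2-coloured graph without `H₁`, two 4-cycles that share an edge `v₀v₃` share a
further vertex. -/
theorem false_of_graphH₁_free {V : Type*} {G : SimpleGraph V} (hfree : graphH₁.Free G)
    (col : G.Coloring (Fin 2)) {v₀ v₁ v₂ v₃ v₄ v₅ : V}
    (h01 : G.Adj v₀ v₁) (h12 : G.Adj v₁ v₂) (h23 : G.Adj v₂ v₃) (h34 : G.Adj v₃ v₄)
    (h45 : G.Adj v₄ v₅) (h50 : G.Adj v₅ v₀) (h03 : G.Adj v₀ v₃)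
    (h02 : v₀ ≠ v₂) (h24 : v₂ ≠ v₄) (h04 : v₀ ≠ v₄)
    (h13 : v₁ ≠ v₃) (h35 : v₃ ≠ v₅) (h15 : v₁ ≠ v₅) : False := by
  have c01 := col.valid h01
  have c12 := col.valid h12
  have c23 := col.valid h23
  have c34 := col.valid h34
  have c45 := col.valid h45
  have h05 := h50.ne'
  have n01 := h01.ne
  have n03 := h03.ne
  have n12 := h12.ne
  have n23 := h23.ne
  have n34 := h34.ne
  have n45 := h45.ne
  -- Vertices at distance 3 along the hexagon have different colours.
  have h14 : v₁ ≠ v₄ := by rintro rfl; omega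
  have h25 : v₂ ≠ v₅ := by rintro rfl; omega
  refine hfree ⟨⟨⟨![v₀, v₁, v₂, v₃, v₄, v₅], ?_⟩, ?_⟩⟩
  · intro i j hij
    fin_cases i <;> fin_cases j <;>
      first
      | assumption
      | (apply SimpleGraph.Adj.symm; assumption)
      | (exfalso; revert hij
         simp only [graphH₁, SimpleGraph.sup_adj, SimpleGraph.cycleGraph_adj,
           SimpleGraph.edge_adj]
         decide)
  · intro i j hij
    fin_cases i <;> fin_cases j <;> simp_all

/-- In a graph without folds and without `H₁`, a walk can be continued at `v` after coming from `p`
to a neighbor that lies in no common 4-cycle with `p` and `v`. -/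
theorem exists_nonbacktracking {V : Type*} {G : SimpleGraph V} (hfree : graphH₁.Free G)
    (col : G.Coloring (Fin 2)) (hconn : G.Connected)
    (hstiff : ∀ v u, v ≠ u → ¬ G.neighborSet v ⊆ G.neighborSet u)
    (hthird : ∀ a b : V, ∃ x, x ≠ a ∧ x ≠ b) {p v : V} (hpv : G.Adj p v) :
    ∃ y, G.Adj v y ∧ y ≠ p ∧ ∀ z, G.Adj y z → G.Adj z p → z = v := by
  by_contra! H
  by_cases hdeg : ∃ y, G.Adj v y ∧ y ≠ p
  · obtain ⟨y, hvy, hyp⟩ := hdeg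
    obtain ⟨z, hyz, hzp, hzv⟩ := H y hvy hyp
    -- If every exit `y'` fails, the same `z` must serve all of them, or two 4-cycles on the edge
    -- `pv` form `H₁`; then `N(v) ⊆ N(z)`.
    refine hstiff v z hzv.symm fun y' hvy' => ?_
    rw [SimpleGraph.mem_neighborSet] at hvy' ⊢
    by_contra hzy'
    have hy'p : y' ≠ p := by rintro rfl; exact hzy' hzp
    obtain ⟨z', hyz', hzp', hzv'⟩ := H y' hvy' hy'p
    exact false_of_graphH₁_free hfree col hvy hyz hzp hzp'.symm hyz'.symm hvy'.symm hpv.symm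
      hzv.symm (by rintro rfl; exact hzy' hyz'.symm) hzv'.symm hyp hy'p.symm
      (by rintro rfl; exact hzy' hyz.symm)
  · push Not at hdeg
    -- Here `N(v) ⊆ {p}`, so stiffness makes `{p, v}` a whole component.
    have hp : ∀ w, G.Adj p w → w = v := by
      intro w hw
      by_contra hwv
      refine hstiff v w (Ne.symm hwv) fun y hy => ?_
      rw [hdeg y hy]
      exact hw.symm
    obtain ⟨x, hxp, hxv⟩ := hthird p v
    have hclosed : ∀ {s t : V}, G.Walk s t → (s = p ∨ s = v) → (t = p ∨ t = v) := by
      intro s t w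
      induction w with
      | nil => exact id
      | cons h w ih =>
        rintro (rfl | rfl)
        · exact ih (Or.inr (hp _ h))
        · exact ih (Or.inl (hdeg _ h))
    obtain ⟨w⟩ := hconn.preconnected p x
    rcases hclosed w (Or.inl rfl) with h | h
    · exact hxp h
    · exact hxv h

/-- If the neighbors of `a` split into `A` and the rest without a 4-cycle at `a` meeting both parts,
then `G` maps to the 6-cycle such that `a` has value `0`, the vertices of `A` have value `1`, the
other neighbors of `a` have value `5`, and values differ by `1` on edges away from `a`. -/
theorem exists_hexagon_levels {V : Type*} {G : SimpleGraph V} (col : G.Coloring (Fin 2)) (a : V)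
    (A : Set V) (hA : A ⊆ G.neighborSet a)
    (hAB : ∀ y, G.Adj a y → y ∉ A → ∀ y' ∈ A, ∀ z, G.Adj y z → G.Adj z y' → z = a) :
    ∃ g : V → ℤ, (∀ x, 0 ≤ g x ∧ g x ≤ 5) ∧ g a = 0 ∧ (∀ y ∈ A, g y = 1) ∧
      (∀ y, G.Adj a y → y ∉ A → g y = 5) ∧
      ∀ x y, x ≠ a → y ≠ a → G.Adj x y → g y - g x = 1 ∨ g y - g x = -1 := by
  classical
  let L : V → Prop := fun x => ∃ y ∈ A, G.Adj x y
  let M : V → Prop := fun x => ∃ z, z ≠ a ∧ G.Adj x z ∧ L z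
  -- Level 1 meets only level 2, and level 5 only level 4, apart from `a`.
  let g : V → ℤ := fun x => if x = a then 0 else if col x = col a then (if L x then 2 else 4)
    else if x ∈ A then 1 else if M x then 3 else 5
  have hodd : ∀ y, G.Adj a y → y ≠ a ∧ col y ≠ col a := fun y hy =>
    ⟨hy.ne', (col.valid hy).symm⟩
  have hstep : ∀ x y, x ≠ a → y ≠ a → G.Adj x y → col x = col a →
      g y - g x = 1 ∨ g y - g x = -1 := by
    intro x y hx hy hxy hcx
    have hcy : col y ≠ col a := fun h => col.valid hxy (hcx.trans h.symm)
    by_cases hL : L x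
    · have hM : M y := ⟨x, hx, hxy.symm, hL⟩
      by_cases hyA : y ∈ A <;> simp [g, hx, hy, hcx, hcy, hL, hM, hyA]
    · have hyA : y ∉ A := fun h => hL ⟨y, h, hxy⟩
      by_cases hM : M y <;> simp [g, hx, hy, hcx, hcy, hL, hM, hyA]
  refine ⟨g, fun x => ?_, by simp [g], fun y hy => ?_, fun y hy hyA => ?_,
    fun x y hx hy hxy => ?_⟩
  · simp only [g]
    split_ifs <;> norm_num
  · simp [g, hodd y (hA hy), hy]
  · have hM : ¬ M y := by
      rintro ⟨z, hza, hyz, y', hy', hzy'⟩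
      exact hza (hAB y hy hyA y' hy' z hyz hzy')
    simp [g, hodd y hy, hyA, hM]
  · by_cases hcx : col x = col a
    · exact hstep x y hx hy hxy hcx
    · have hcy : col y = col a := by
        have := col.valid hxy
        omega
      have := hstep y x hy hx hxy.symm hcy
      omega

/-- A residue of an integer modulo `3` as a colour. -/
def intColor (n : ℤ) : Fin 3 :=
  ((n : ZMod 3) : Fin 3)

theorem intColor_add_one (n : ℤ) : intColor (n + 1) = intColor n + 1 := by
  show (((n + 1 : ℤ) : ZMod 3)) = (n : ZMod 3) + 1
  push_cast
  rfl

theorem colorStep_intColor {m n : ℤ} (h : n - m = 1 ∨ n - m = -1) :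
    colorStep (intColor m) (intColor n) = n - m := by
  have h1 : ∀ a : Fin 3, colorStep a (a + 1) = 1 ∧ colorStep (a + 1) a = -1 := by decide
  rcases h with h | h
  · rw [show n = m + 1 by omega, intColor_add_one, (h1 _).1]; ring
  · rw [show m = n + 1 by omega, intColor_add_one, (h1 _).2]; ring

theorem colorStep_eq_zero_iff (a b : Fin 3) : colorStep a b = 0 ↔ a = b := by
  revert a b
  decide

/-- A sequence in a finite type whose consecutive terms differ returns to some term `x i` without
having returned to `x (i + 1)`. -/
theorem exists_first_return {V : Type*} [Finite V] (x : ℕ → V)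
    (h1 : ∀ n, x n ≠ x (n + 1)) :
    ∃ i j, i + 2 ≤ j ∧ x j = x i ∧ ∀ k, i + 2 ≤ k → k ≤ j → x k ≠ x (i + 1) := by
  classical
  have hex : ∃ j, ∃ i, i < j ∧ x i = x j := by
    obtain ⟨i, j, hij, h⟩ := Finite.exists_ne_map_eq_of_infinite x
    rcases lt_or_gt_of_ne hij with h' | h'
    · exact ⟨j, i, h', h⟩
    · exact ⟨i, j, h', h.symm⟩
  obtain ⟨i, hij, hx⟩ := Nat.find_spec hex
  have hmin := fun m (hm : m < Nat.find hex) => Nat.find_min hex hm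
  set j := Nat.find hex
  have hj : i + 2 ≤ j := by
    by_contra h
    have : j = i + 1 := by omega
    rw [this] at hx
    exact h1 i hx
  refine ⟨i, j, hj, hx.symm, fun k hk hkj hxk => ?_⟩
  rcases hkj.lt_or_eq with h | rfl
  · exact hmin k h ⟨i + 1, by omega, hxk.symm⟩
  · exact h1 i (hx.trans hxk)

theorem exists_winding_coloring {V : Type*} [Finite V] {G : SimpleGraph V}
    (hfree : graphH₁.Free G) (col : G.Coloring (Fin 2)) (hconn : G.Connected)
    (hstiff : ∀ v u, v ≠ u → ¬ G.neighborSet v ⊆ G.neighborSet u)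
    (hthird : ∀ a b : V, ∃ x, x ≠ a ∧ x ≠ b) {s t : V} (hst : G.Adj s t) :
    ∃ c : V → Fin 3, (∀ x y, G.Adj x y → c x ≠ c y) ∧
      ∃ (u : V) (w : G.Walk u u), windingSum c w ≠ 0 := by
  have : Nonempty V := ⟨s⟩
  choose! next hnext using fun (d : V × V) (hd : G.Adj d.1 d.2) =>
    exists_nonbacktracking hfree col hconn hstiff hthird hd
  let d : ℕ → V × V := fun n => (fun e : V × V => (e.2, next e))^[n] (s, t)
  have hd : ∀ n, d (n + 1) = ((d n).2, next (d n)) := fun n =>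
    Function.iterate_succ_apply' _ _ _
  have hadj : ∀ n, G.Adj (d n).1 (d n).2 := by
    intro n
    induction n with
    | zero => exact hst
    | succ n ih => rw [hd]; exact (hnext _ ih).1
  let x : ℕ → V := fun n => (d n).1
  have hx1 : ∀ n, x (n + 1) = (d n).2 := fun n => by simp only [x, hd]
  have hx2 : ∀ n, x (n + 2) = next (d n) := fun n => by rw [hx1, hd]
  have hxadj : ∀ n, G.Adj (x n) (x (n + 1)) := fun n => by rw [hx1]; exact hadj n
  have hxne : ∀ n, x (n + 2) ≠ x n := fun n => by rw [hx2]; exact (hnext _ (hadj n)).2.1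
  have hxsq : ∀ n z, G.Adj (x (n + 2)) z → G.Adj z (x n) → z = x (n + 1) := fun n => by
    rw [hx2, hx1]; exact (hnext _ (hadj n)).2.2
  obtain ⟨i, j, hij, hxj, hav⟩ :=
    exists_first_return x fun n => (hxadj n).ne
  let a := x (i + 1)
  let b := x i
  -- The complement of `A` in `N(a)` is the 4-cycle class of `b`.
  let A : Set V := {y | G.Adj a y ∧ y ≠ b ∧ ∀ z, G.Adj y z → G.Adj z b → z = a}
  have hbA : b ∉ A := fun h => h.2.1 rfl
  have hAB : ∀ y, G.Adj a y → y ∉ A → ∀ y' ∈ A, ∀ z, G.Adj y z → G.Adj z y' → z = a := by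
    rintro y hay hyA y' ⟨hay', hy'b, hy'⟩ z hyz hzy'
    by_contra hza
    by_cases hyb : y = b
    · subst hyb
      exact hza (hy' z hzy'.symm hyz.symm)
    have : ∃ z', G.Adj y z' ∧ G.Adj z' b ∧ z' ≠ a := by
      by_contra! h
      exact hyA ⟨hay, hyb, h⟩
    obtain ⟨z', hyz', hzb', hza'⟩ := this
    exact false_of_graphH₁_free hfree col (hxadj i).symm hzb'.symm hyz'.symm hyz hzy' hay'.symm hay
      (Ne.symm hza') (by rintro rfl; exact hza (hy' _ hzy'.symm hzb')) (Ne.symm hza) (Ne.symm hyb)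
      (by rintro rfl; exact hyA ⟨hay, hy'b, hy'⟩) (Ne.symm hy'b)
  obtain ⟨g, hg, hga, hgA, hgB, hgadj⟩ := exists_hexagon_levels col a A (fun y hy => hy.1) hAB
  have hA1 : ∀ y ∈ A, colorStep (intColor (g a)) (intColor (g y)) = 1 := fun y hy => by
    rw [hga, hgA y hy]; decide
  have hB1 : ∀ y, G.Adj a y → y ∉ A → colorStep (intColor (g y)) (intColor (g a)) = 1 :=
    fun y hy hyA => by rw [hga, hgB y hy hyA]; decide
  have hapr : ∀ y, G.Adj a y → intColor (g a) ≠ intColor (g y) := by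
    intro y hy h
    by_cases hyA : y ∈ A
    · have := hA1 y hyA
      rw [(colorStep_eq_zero_iff _ _).2 h] at this
      omega
    · have := hB1 y hy hyA
      rw [(colorStep_eq_zero_iff _ _).2 h.symm] at this
      omega
  refine ⟨fun v => intColor (g v), fun v w hvw => ?_, ?_⟩
  · by_cases hv : v = a
    · subst hv; exact hapr w hvw
    by_cases hw : w = a
    · subst hw; exact (hapr v hvw.symm).symm
    have h := hgadj v w hv hw hvw
    intro h'
    rw [← colorStep_eq_zero_iff, colorStep_intColor h] at h'
    omega
  · have hwalk : ∀ k, i + 2 ≤ k → k ≤ j → ∃ p : G.Walk (x (i + 2)) (x k),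
        windingSum (fun v => intColor (g v)) p = g (x k) - g (x (i + 2)) := by
      intro k hk
      induction k, hk using Nat.le_induction with
      | base => exact fun _ => ⟨.nil, by simp [windingSum]⟩
      | succ k hk ih =>
        intro hkj
        obtain ⟨p, hp⟩ := ih (by omega)
        refine ⟨p.append (.cons (hxadj k) .nil), ?_⟩
        rw [windingSum_append, hp, windingSum, windingSum, colorStep_intColor
          (hgadj _ _ (hav k hk (by omega)) (hav (k + 1) (by omega) hkj) (hxadj k))]
        ring
    obtain ⟨p, hp⟩ := hwalk j hij le_rfl
    have hmA : x (i + 2) ∈ A := ⟨hxadj (i + 1), hxne i, hxsq i⟩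
    have hjb : x j = b := hxj
    have hja : G.Adj (x j) a := by rw [hjb]; exact hxadj i
    -- Levels run 0, 1, …, 5, 0 with winding `1 + (5 - 1) + 1 = 6`: from 5 to 0 the colour step is
    -- `+1`.
    refine ⟨a, .cons (hxadj (i + 1)) (p.append (.cons hja .nil)), ?_⟩
    rw [windingSum, windingSum_append, hp, windingSum, windingSum, hA1 _ hmA,
      hB1 (x j) hja.symm (by rwa [hjb]), hgA _ hmA, hgB (x j) hja.symm (by rwa [hjb])]
    norm_num

theorem theorem4p7 {V : Type*} [Finite V] [Nontrivial V] (G : SimpleGraph V)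
    (hbip : G.IsBipartite) (hconn : G.Connected) (hfold : ¬ FoldsToEdge G)
    (hH₁ : graphH₁.Free G) (hH₂ : graphH₂.Free G) :
    (homComplex G (SimpleGraph.completeGraph (Fin 3))).Nonempty ∧
      ¬ IsPreconnected (homComplex G (SimpleGraph.completeGraph (Fin 3))) := by
  obtain ⟨col⟩ := hbip
  have hcast : ∀ i j : Fin 2, i ≠ j → i.castSucc ≠ j.castSucc ∧
      colorStep i.castSucc j.castSucc = (j.val : ℤ) - (i.val : ℤ) := by decide
  have h₀ : ∀ x y, G.Adj x y → (col x).castSucc ≠ (col y).castSucc :=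
    fun x y h => (hcast _ _ (col.valid h)).1
  refine ⟨⟨_, Set.mem_biUnion (isHomCell_singleton _ h₀) (single_mem_homCellRealization _)⟩, ?_⟩
  obtain ⟨S, hS, hmin⟩ := Set.Finite.exists_minimal (Set.toFinite {S : Set V | FoldsTo G S})
    ⟨_, FoldsTo.refl⟩
  obtain ⟨ρ, hρ⟩ := hS.exists_retraction
  let ι : G.induce S →g G := (SimpleGraph.Embedding.induce S).toHom
  obtain ⟨x₀, -⟩ := exists_pair_ne V
  obtain ⟨y₀, hxy⟩ := hconn.preconnected.exists_adj_of_nontrivial x₀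
  have hSconn : (G.induce S).Connected :=
    hconn.map ρ fun x => ⟨x, hρ x⟩
  have hstiff : ∀ v u : S, v ≠ u →
      ¬ (G.induce S).neighborSet v ⊆ (G.induce S).neighborSet u := by
    intro v u hvu hN
    have hf : FoldsTo G (S \ {v.1}) := FoldsTo.fold S v u hS v.2 u.2
      (fun h => hvu (Subtype.ext h)) fun y hy => ⟨hN (a := ⟨y, hy.2⟩) hy.1, hy.2⟩
    exact (hmin hf Set.sdiff_subset v.2).2 rfl
  have hthird : ∀ a b : S, ∃ x, x ≠ a ∧ x ≠ b := by
    intro a b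
    by_contra! H
    -- With at most two vertices, `S` is the image of an edge under `ρ`, so `G` would fold to an
    -- edge.
    have hab : S = {(ρ x₀).1, (ρ y₀).1} := by
      have hne := (ρ.map_adj hxy).ne
      ext z
      constructor
      · intro hz
        have h1 := H ⟨z, hz⟩
        have h2 := H (ρ x₀)
        have h3 := H (ρ y₀)
        have : (⟨z, hz⟩ : S) = ρ x₀ ∨ (⟨z, hz⟩ : S) = ρ y₀ := by
          clear hmin hρ hstiff hSconn
          generalize (⟨z, hz⟩ : S) = e at *
          by_cases ea : e = a <;> by_cases xa : ρ x₀ = a <;> by_cases ya : ρ y₀ = a <;>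
            simp_all
        rcases this with h | h
        · exact Or.inl (congrArg Subtype.val h)
        · exact Or.inr (congrArg Subtype.val h)
      · rintro (rfl | rfl)
        exacts [(ρ x₀).2, (ρ y₀).2]
    exact hfold ⟨_, _, ρ.map_adj hxy, hab ▸ hS⟩
  have hfree : graphH₁.Free (G.induce S) := fun h =>
    hH₁ (h.trans ⟨⟨ι, Subtype.val_injective⟩⟩)
  obtain ⟨c, hc, u, w, hw⟩ := exists_winding_coloring hfree (col.comp ι) hSconn hstiff hthird
    (ρ.map_adj hxy)
  have hcι : (c ∘ ρ) ∘ ι = c := funext fun x => congrArg c (hρ x)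
  refine not_isPreconnected_homComplex G h₀ (c₁ := c ∘ ρ)
    (fun x y h => hc _ _ (ρ.map_adj h)) (w.map ι) ?_
  rw [windingSum_map ι (c ∘ ρ), hcι, windingSum_eq_sub _ (fun x => ((col x).val : ℤ))
    fun x y h => (hcast _ _ (col.valid h)).2]
  simpa using hw.symm
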